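/- All spaces are $T_1$. For a space $X$ let $\omega(X)$ be the union of all open subspaces $U\subseteq X$ with covering dimension $\dim U=0$, and let $c\omega(X)=X\setminus\omega(X)$. A space is *paracompact* (*strongly paracompact*) if it is Hausdorff and each of its open covers has a locally finite (star-finite) open refinement; a family of sets is *star-finite* if each member meets only finitely many members. A *shrinking* of a cover $\{U_\alpha:\alpha\in A\}$ is a cover $\{V_\alpha:\alpha\in A\}$ with $V_\alpha\subseteq U_\alpha$ for all $\alpha\in A$. A set-valued mapping $\theta:X\to Y$ assigns to each $x\in X$ a non-empty set $\theta(x)\subseteq Y$; put $\theta^{-1}(B)=\{x:\theta(x)\cap B\ne\emptyset\}$ and $\theta(A)=\bigcup_{x\in A}\theta(x)$. It is lower (upper) semi-continuous if $\theta^{-1}(B)$ is open (closed) for every open (closed) $B\subseteq Y$. A *selection* of $\theta$ is a set-valued mapping $\psi:X\to Y$ with $\psi(x)\subseteq\theta(x)$ for all $x$. Put $\psi^1(x)=\psi(x)$, $\psi^{n+1}(x)=\psi(\psi^{-1}(\psi^n(x)))$ and $\psi^\infty(x)=\bigcup_{n\ge1}\psi^n(x)$. **Corollary 3.3.** For a $T_1$-space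 $X$ the following assertions are equivalent: 1. $X$ is paracompact and $c\omega(X)$ is compact. 2. $X$ is strongly paracompact and $c\omega(X)$ is compact. 3. For every lower semi-continuous closed-valued mapping $\theta:X\to Y$ into a complete metric space $Y$ there exist an upper semi-continuous compact-valued selection $\psi:X\to Y$ of $\theta$ and a closed $G_\delta$-subset $H$ of $X$ such that $c\omega(X)\subseteq H$, $\mathrm{cl}_Y\,\psi(H)$ is compact, and $\psi(x)$ is a one-point set for every $x\in X\setminus H$. 4. For every lower semi-continuous closed-valued mapping $\theta:X\to Y$ into a complete metric space $Y$ there exists an upper semi-continuous selection $\psi:X\to Y$ of $\theta$ such that $\mathrm{cl}_Y\,\psi^\infty(x)$ is compact for every $x\in X$. 5. For every lower semi-continuous mapping $\theta:X\to Y$ into a discrete space $Y$ there exists an upper semi-continuous selection $\psi:X\to Y$ of $\theta$ such that $\psi^\infty(x)$ is finite for every $x\in X$. 6. $X$ is Hausdorff and every open cover of $X$ has an open star-finite shrinking. -/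

import Mathlib

open Set Topology

universe u v

namespace CozeroKernel

/-- `𝒰` is an open cover of `X` (a cover given as a set of subsets of `X`). -/
def IsOpenCover {X : Type u} [TopologicalSpace X] (𝒰 : Set (Set X)) : Prop :=
  (∀ U ∈ 𝒰, IsOpen U) ∧ ⋃₀ 𝒰 = univ

/-- `𝒱` refines `𝒰`: every member of `𝒱` is contained in some member of `𝒰`. -/
def Refines {X : Type u} (𝒱 𝒰 : Set (Set X)) : Prop :=
  ∀ V ∈ 𝒱, ∃ U ∈ 𝒰, V ⊆ U

/-- The inequality `dim X ≤ n` for the (Lebesgue) covering dimension: every finite open cover of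
`X` has a finite open refinement, covering `X`, such that every point lies in at most `n + 1`
of its members. -/
def CoveringDimLE (X : Type u) [TopologicalSpace X] (n : ℕ) : Prop :=
  ∀ 𝒰 : Set (Set X), 𝒰.Finite → IsOpenCover 𝒰 →
    ∃ 𝒱 : Set (Set X), 𝒱.Finite ∧ IsOpenCover 𝒱 ∧ Refines 𝒱 𝒰 ∧
      ∀ x : X, {V ∈ 𝒱 | x ∈ V}.encard ≤ n + 1

/-- `dim X = 0` (the empty space has dimension `-1`). -/
def DimEqZero (X : Type u) [TopologicalSpace X] : Prop :=
  Nonempty X ∧ CoveringDimLE X 0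

/-- `ω(X)`, the union of all open subspaces `U` of `X` with `dim U = 0`. -/
def omegaPart (X : Type u) [TopologicalSpace X] : Set X :=
  ⋃₀ {U : Set X | IsOpen U ∧ DimEqZero U}

/-- The cozero-dimensional kernel `cω(X) = X \ ω(X)`. -/
def cozeroKernel (X : Type u) [TopologicalSpace X] : Set X :=
  (omegaPart X)ᶜ

/-- An indexed family of sets is star-finite if every member meets only finitely many members. -/
def StarFinite {X : Type u} {ι : Type*} (V : ι → Set X) : Prop :=
  ∀ i, {j | (V j ∩ V i).Nonempty}.Finite

/-- Paracompact: Hausdorff, and every open cover has a locally finite open refinement. -/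
def IsParacompactHausdorff (X : Type u) [TopologicalSpace X] : Prop :=
  T2Space X ∧ ParacompactSpace X

/-- Strongly paracompact (hypocompact): Hausdorff, and every open cover has a star-finite open
refinement. -/
def IsStronglyParacompact (X : Type u) [TopologicalSpace X] : Prop :=
  T2Space X ∧ ∀ 𝒰 : Set (Set X), IsOpenCover 𝒰 →
    ∃ 𝒱 : Set (Set X), IsOpenCover 𝒱 ∧ Refines 𝒱 𝒰 ∧ StarFinite (fun V : 𝒱 => (V : Set X))

section SetValued

variable {X : Type u} {Y : Type v}

/-- A map `X → Set Y` is a set-valued mapping from `X` to `Y` if all its values are non-empty. -/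
def IsSetValuedMap (θ : X → Set Y) : Prop := ∀ x, (θ x).Nonempty

/-- `ψ` is a (set-valued) selection of `θ`. -/
def IsSelection (ψ θ : X → Set Y) : Prop :=
  IsSetValuedMap ψ ∧ ∀ x, ψ x ⊆ θ x

/-- The image `θ(A) = ⋃ {θ(x) : x ∈ A}`. -/
def image (θ : X → Set Y) (A : Set X) : Set Y := ⋃ x ∈ A, θ x

/-- The inverse image `θ⁻¹(B) = {x : θ(x) ∩ B ≠ ∅}`. -/
def invImage (θ : X → Set Y) (B : Set Y) : Set X := {x | (θ x ∩ B).Nonempty}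

/-- The iterated images, indexed from `0`: `iterImage θ A n` is the `(n+1)`-image of `A`, so
`θ¹(A) = θ(A)` and `θⁿ⁺¹(A) = θ(θ⁻¹(θⁿ(A)))`. -/
def iterImage (θ : X → Set Y) (A : Set X) : ℕ → Set Y
  | 0 => image θ A
  | n + 1 => image θ (invImage θ (iterImage θ A n))

/-- The largest image `θ^∞(A)`, the union of all `n`-images of `A`, `n ≥ 1`. -/
def largestImage (θ : X → Set Y) (A : Set X) : Set Y := ⋃ n, iterImage θ A n

end SetValued

/-- Every lower semi-continuous closed-valued mapping `θ` of `X` into a complete metric space `Y`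
has an upper semi-continuous compact-valued selection `ψ` and a closed `G_δ` set `H ⊇ cω(X)` such
that `cl ψ(H)` is compact and `ψ(x)` is a one-point set for every `x ∉ H`. -/
def HasKernelSelections (X : Type u) [TopologicalSpace X] : Prop :=
  ∀ (Y : Type (max u v)) [MetricSpace Y] [CompleteSpace Y] (θ : X → Set Y),
    IsSetValuedMap θ → LowerHemicontinuous θ → (∀ x, IsClosed (θ x)) →
    ∃ (ψ : X → Set Y) (H : Set X),
      IsSelection ψ θ ∧ UpperHemicontinuous ψ ∧ (∀ x, IsCompact (ψ x)) ∧
      IsClosed H ∧ IsGδ H ∧ cozeroKernel X ⊆ H ∧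
      IsCompact (closure (image ψ H)) ∧ ∀ x ∉ H, ∃ y, ψ x = {y}

/-- Every lower semi-continuous closed-valued mapping `θ` of `X` into a complete metric space `Y`
has an upper semi-continuous selection `ψ` such that `cl ψ^∞(x)` is compact for every `x`. -/
def HasCompactLargestImageSelections (X : Type u) [TopologicalSpace X] : Prop :=
  ∀ (Y : Type (max u v)) [MetricSpace Y] [CompleteSpace Y] (θ : X → Set Y),
    IsSetValuedMap θ → LowerHemicontinuous θ → (∀ x, IsClosed (θ x)) →
    ∃ ψ : X → Set Y, IsSelection ψ θ ∧ UpperHemicontinuous ψ ∧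
      ∀ x, IsCompact (closure (largestImage ψ {x}))

/-- Every lower semi-continuous mapping `θ` of `X` into a discrete space `Y` has an upper
semi-continuous selection `ψ` such that `ψ^∞(x)` is finite for every `x`. -/
def HasFiniteLargestImageSelections (X : Type u) [TopologicalSpace X] : Prop :=
  ∀ (Y : Type (max u v)) [TopologicalSpace Y] [DiscreteTopology Y] (θ : X → Set Y),
    IsSetValuedMap θ → LowerHemicontinuous θ →
    ∃ ψ : X → Set Y, IsSelection ψ θ ∧ UpperHemicontinuous ψ ∧
      ∀ x, (largestImage ψ {x}).Finite

/-- Every open cover `(U_i)` of `X` has an open star-finite shrinking `(V_i)`: a star-finite open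
cover with the same index set and `V_i ⊆ U_i` for every `i`. -/
def HasStarFiniteShrinkings (X : Type u) [TopologicalSpace X] : Prop :=
  ∀ (ι : Type (max u v)) (U : ι → Set X), (∀ i, IsOpen (U i)) → ⋃ i, U i = univ →
    ∃ V : ι → Set X, (∀ i, IsOpen (V i)) ∧ ⋃ i, V i = univ ∧ (∀ i, V i ⊆ U i) ∧ StarFinite V

end CozeroKernel

/-! ### Zero-dimensionality as clopen separation -/

namespace CozeroKernel

/-! The implications run 2 → 1 → 3 → 4 → 5 → 6 → 2; the substance is in 1 → 3, 5 → 6 and 6 → 2.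

1 → 3: off any neighbourhood of the compact kernel, an open cover has a disjoint open refinement
with clopen union (`exists_disjoint_open_family`), while near the kernel finitely many members
suffice. Hence `θ` has finite-valued approximations, single-valued off a clopen set `E n` and with
finitely many values on it. Refining them with errors `1 / 2 ^ n` yields `ψ` in the limit, with `H =
⋂ n, E n`.

3 → 4 → 5 → 6: the sets `ψ^∞(x)` partition the image of `ψ`. Singleton values off `H` make `ψ(H)` a
union of classes and every other class a point. For the map `x ↦ {i | x ∈ U i}`, the class of `x` is
locally constant in `x`, so intersecting `U i` with the set of points whose class contains `i` gives
a star-finite shrinking.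

6 → 2: were the kernel not compact, it would contain points with locally finite disjoint
neighbourhoods `W n`, each holding a closed pair not separated inside it. A star-finite shrinking of
a suitable cover separates one of these pairs (`HasStarFiniteShrinkings.isCompact_cozeroKernel`). -/

/-- Disjoint closed sets can be separated by clopen sets. -/
def HasClopenSeparation (X : Type u) [TopologicalSpace X] : Prop :=
  ∀ A B : Set X, IsClosed A → IsClosed B → Disjoint A B → ∃ C, IsClopen C ∧ A ⊆ C ∧ Disjoint C B

/-- Inside `Q`, disjoint closed sets can be separated by clopen sets of the ambient space. -/
def SeparatesIn {X : Type u} [TopologicalSpace X] (Q : Set X) : Prop :=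
  ∀ A B : Set X, IsClosed A → IsClosed B → Disjoint A B →
    ∃ C, IsClopen C ∧ A ∩ Q ⊆ C ∧ C ⊆ Q \ B

variable {X : Type u} [TopologicalSpace X]

theorem CoveringDimLE.hasClopenSeparation (h : CoveringDimLE X 0) : HasClopenSeparation X := by
  intro A B hA hB hAB
  obtain ⟨𝒱, -, ⟨hVo, hVc⟩, hVr, hV1⟩ := h {Aᶜ, Bᶜ} (by simp)
    ⟨by rintro U (rfl | rfl); exacts [hA.isOpen_compl, hB.isOpen_compl], by
      rw [sUnion_pair, ← compl_inter, hAB.inter_eq, compl_empty]⟩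
  have huniq : ∀ V ∈ 𝒱, ∀ W ∈ 𝒱, ∀ x, x ∈ V → x ∈ W → V = W := by
    intro V hV W hW x hxV hxW
    have h1 : {V ∈ 𝒱 | x ∈ V}.encard ≤ 1 := by simpa using hV1 x
    exact encard_le_one_iff.1 h1 V W ⟨hV, hxV⟩ ⟨hW, hxW⟩
  have hcov : ∀ x, ∃ V ∈ 𝒱, x ∈ V := fun x => by
    have : x ∈ ⋃₀ 𝒱 := hVc ▸ mem_univ x
    exact this
  -- The members of `𝒱` are disjoint, so any union of them is clopen; those not inside `Aᶜ` lie
  -- inside `Bᶜ`.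
  refine ⟨⋃₀ {V ∈ 𝒱 | ¬ V ⊆ Aᶜ}, ⟨?_, isOpen_sUnion fun V hV => hVo V hV.1⟩, ?_, ?_⟩
  · have : (⋃₀ {V ∈ 𝒱 | ¬ V ⊆ Aᶜ})ᶜ = ⋃₀ {V ∈ 𝒱 | V ⊆ Aᶜ} := by
      ext x
      obtain ⟨V, hV, hx⟩ := hcov x
      constructor
      · intro hn
        by_cases hVA : V ⊆ Aᶜ
        · exact ⟨V, ⟨hV, hVA⟩, hx⟩
        · exact (hn ⟨V, ⟨hV, hVA⟩, hx⟩).elim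
      · rintro ⟨W, ⟨hW, hWA⟩, hxW⟩ ⟨W', ⟨hW', hWA'⟩, hxW'⟩
        exact hWA' (huniq W hW W' hW' x hxW hxW' ▸ hWA)
    rw [← isOpen_compl_iff, this]
    exact isOpen_sUnion fun V hV => hVo V hV.1
  · intro x hx
    obtain ⟨V, hV, hxV⟩ := hcov x
    exact ⟨V, ⟨hV, fun hs => hs hxV hx⟩, hxV⟩
  · rw [disjoint_left]
    rintro x ⟨V, ⟨hV, hVA⟩, hxV⟩ hxB
    obtain ⟨U, hU, hVU⟩ := hVr V hV
    rcases hU with rfl | rfl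
    · exact hVA hVU
    · exact hVU hxV hxB

/-- Induction on the cover: a clopen `C` separating the points covered only by `U` from those
outside `U` splits off `P ∩ C ⊆ U`, and the remaining members cover `P \ C`. The clopen set `P`
varies to make the induction work. -/
theorem HasClopenSeparation.exists_disjoint_refinement (h : HasClopenSeparation X)
    {𝒰 : Set (Set X)} (hf : 𝒰.Finite) (ho : ∀ U ∈ 𝒰, IsOpen U) :
    ∀ P : Set X, IsClopen P → P ⊆ ⋃₀ 𝒰 → ∃ 𝒱 : Set (Set X), 𝒱.Finite ∧ (∀ V ∈ 𝒱, IsOpen V) ∧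
      ⋃₀ 𝒱 = P ∧ Refines 𝒱 𝒰 ∧ 𝒱.PairwiseDisjoint id := by
  induction 𝒰, hf using Set.Finite.induction_on with
  | empty =>
    intro P _ hP
    refine ⟨∅, finite_empty, by simp, ?_, by simp [Refines], by simp⟩
    simp only [sUnion_empty, subset_empty_iff] at hP ⊢
    exact hP.symm
  | @insert U 𝒰 _ _ ih =>
    intro P hP hPU
    have hU : IsOpen U := ho U (mem_insert _ _)
    have ho' : ∀ U ∈ 𝒰, IsOpen U := fun W hW => ho W (mem_insert_of_mem _ hW)
    rw [sUnion_insert] at hPU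
    obtain ⟨C, hC, hAC, hCB⟩ := h (P \ ⋃₀ 𝒰) (P \ U) (hP.1.sdiff (isOpen_sUnion ho'))
      (hP.1.sdiff hU) (disjoint_left.2 fun x hx hx' => (hPU hx.1).elim hx'.2 hx.2)
    obtain ⟨𝒱, hVf, hVo, hVP, hVr, hVd⟩ := ih ho' (P \ C) (hP.diff hC) fun x hx => by
      by_contra hn
      exact hx.2 (hAC ⟨hx.1, hn⟩)
    refine ⟨insert (P ∩ C) 𝒱, hVf.insert _, ?_, ?_, ?_, ?_⟩
    · rintro V (rfl | hV)
      exacts [hP.2.inter hC.2, hVo V hV]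
    · rw [sUnion_insert, hVP, inter_union_sdiff]
    · rintro V (rfl | hV)
      · refine ⟨U, mem_insert _ _, fun x hx => ?_⟩
        by_contra hn
        exact disjoint_left.1 hCB hx.2 ⟨hx.1, hn⟩
      · obtain ⟨W, hW, hVW⟩ := hVr V hV
        exact ⟨W, mem_insert_of_mem _ hW, hVW⟩
    · refine hVd.insert fun V hV _ => disjoint_left.2 fun x hx hxV => ?_
      have : x ∈ P \ C := hVP ▸ ⟨V, hV, hxV⟩
      exact this.2 hx.2

theorem HasClopenSeparation.coveringDimLE (h : HasClopenSeparation X) : CoveringDimLE X 0 := by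
  intro 𝒰 hf hU
  obtain ⟨𝒱, hVf, hVo, hVP, hVr, hVd⟩ :=
    h.exists_disjoint_refinement hf hU.1 univ isClopen_univ hU.2.ge
  refine ⟨𝒱, hVf, ⟨hVo, hVP⟩, hVr, fun x => ?_⟩
  simp only [Nat.cast_zero, zero_add]
  refine encard_le_one_iff.2 fun V W hV hW => ?_
  by_contra hne
  exact disjoint_left.1 (hVd hV.1 hW.1 hne) hV.2 hW.2

theorem isClopen_image_val {U N : Set X} (hU : IsOpen U) (hN : IsClosed N) (hNU : N ⊆ U)
    {C : Set U} (hC : IsClopen C) (hCN : Subtype.val '' C ⊆ N) :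
    IsClopen (Subtype.val '' C : Set X) := by
  refine ⟨?_, hU.isOpenMap_subtype_val _ hC.2⟩
  obtain ⟨Z, hZ, rfl⟩ := isClosed_induced_iff.1 hC.1
  have : (Subtype.val '' (Subtype.val ⁻¹' Z : Set U) : Set X) = N ∩ Z := by
    refine subset_antisymm (fun x hx => ⟨hCN hx, ?_⟩) fun x hx => ⟨⟨x, hNU hx.1⟩, hx.2, rfl⟩
    obtain ⟨y, hy, rfl⟩ := hx
    exact hy
  rw [this]
  exact hN.inter hZ

theorem mem_omegaPart_of_isClopen {x : X} {Q : Set X} (hQ : IsClopen Q) (hx : x ∈ Q)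
    (hs : SeparatesIn Q) : x ∈ omegaPart X := by
  refine ⟨Q, ⟨hQ.2, ⟨⟨x, hx⟩⟩, HasClopenSeparation.coveringDimLE fun A B hA hB hAB => ?_⟩, hx⟩
  obtain ⟨C, hC, hAC, hCB⟩ := hs (Subtype.val '' A) (Subtype.val '' B)
    (hQ.1.isClosedMap_subtype_val _ hA) (hQ.1.isClosedMap_subtype_val _ hB)
    ((disjoint_image_iff Subtype.val_injective).2 hAB)
  exact ⟨Subtype.val ⁻¹' C, hC.preimage continuous_subtype_val,
    fun a ha => hAC ⟨mem_image_of_mem _ ha, a.2⟩,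
    disjoint_left.2 fun a ha hb => (hCB ha).2 (mem_image_of_mem _ hb)⟩

theorem exists_isClopen_of_mem_omegaPart [T3Space X] {x : X} (hx : x ∈ omegaPart X) :
    ∃ Q : Set X, IsClopen Q ∧ x ∈ Q ∧ Q ⊆ omegaPart X ∧ SeparatesIn Q := by
  obtain ⟨U, ⟨hU, -, hd⟩, hxU⟩ := hx
  have hsep := hd.hasClopenSeparation
  obtain ⟨N, hN, hNc, hNU⟩ := exists_mem_nhds_isClosed_subset (hU.mem_nhds hxU)
  obtain ⟨C, hC, hxC, hCN⟩ := hsep {⟨x, hxU⟩} (Subtype.val ⁻¹' (interior N)ᶜ) isClosed_singleton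
    (isOpen_interior.isClosed_compl.preimage continuous_subtype_val)
    (disjoint_singleton_left.2 fun h => h (mem_interior_iff_mem_nhds.2 hN))
  have hCN' : Subtype.val '' C ⊆ N := by
    rintro _ ⟨y, hy, rfl⟩
    by_contra hn
    exact disjoint_left.1 hCN hy fun h => hn (interior_subset h)
  have hs : SeparatesIn (Subtype.val '' C : Set X) := by
    intro A B hA hB hAB
    obtain ⟨D, hD, hAD, hDB⟩ := hsep (Subtype.val ⁻¹' A) (Subtype.val ⁻¹' B)
      (hA.preimage continuous_subtype_val) (hB.preimage continuous_subtype_val)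
      (hAB.preimage _)
    refine ⟨Subtype.val '' (D ∩ C), isClopen_image_val hU hNc hNU (hD.inter hC)
      ((image_mono inter_subset_right).trans hCN'), ?_, ?_⟩
    · rintro _ ⟨hA, y, hy, rfl⟩
      exact ⟨y, ⟨hAD hA, hy⟩, rfl⟩
    · rintro _ ⟨y, hy, rfl⟩
      exact ⟨⟨y, hy.2, rfl⟩, fun hB => disjoint_left.1 hDB hy.1 hB⟩
  have hQ := isClopen_image_val hU hNc hNU hC hCN'
  exact ⟨_, hQ, ⟨_, hxC rfl, rfl⟩, fun y hy => mem_omegaPart_of_isClopen hQ hy hs, hs⟩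

/-- Otherwise, in a closed neighbourhood `N ⊆ W` of `x`, separating `x` from `N \ interior N` gives
a set `Q ∋ x` clopen in `X`, and separation within `N` makes `Q` zero-dimensional, so that `x ∈
ω(X)`. Relative clopenness in `P` is expressed by closedness of `C` and `P \ C`, avoiding subtypes.
-/
theorem exists_not_separated_of_mem_cozeroKernel [T3Space X] {x : X} (hx : x ∈ cozeroKernel X)
    {W : Set X} (hW : IsOpen W) (hxW : x ∈ W) :
    ∃ P A B : Set X, IsClosed P ∧ IsClosed A ∧ IsClosed B ∧ P ⊆ W ∧ A ⊆ P ∧ B ⊆ P ∧ Disjoint A B ∧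
      ∀ C, IsClosed C → IsClosed (P \ C) → A ⊆ C → C ⊆ P → ¬ Disjoint C B := by
  by_contra! hcon
  obtain ⟨N, hN, hNc, hNW⟩ := exists_mem_nhds_isClosed_subset (hW.mem_nhds hxW)
  obtain ⟨Q, hQc, hQc', hxQ, hQN, hQd⟩ := hcon N {x} (N \ interior N) hNc isClosed_singleton
    (hNc.sdiff isOpen_interior) hNW (singleton_subset_iff.2 (mem_of_mem_nhds hN)) sdiff_subset
    (disjoint_singleton_left.2 fun h => h.2 (mem_interior_iff_mem_nhds.2 hN))
  have hQi : Q ⊆ interior N := fun y hy => by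
    by_contra hn
    exact disjoint_left.1 hQd hy ⟨hQN hy, hn⟩
  have hQo : IsOpen Q := by
    have : Q = interior N \ (N \ Q) := by
      ext y
      exact ⟨fun h => ⟨hQi h, fun h' => h'.2 h⟩, fun h => by
        by_contra hn
        exact h.2 ⟨interior_subset h.1, hn⟩⟩
    rw [this]
    exact isOpen_interior.sdiff hQc'
  refine hx (mem_omegaPart_of_isClopen ⟨hQc, hQo⟩ (hxQ rfl) fun A B hA hB hAB => ?_)
  obtain ⟨C, hC, hC', hAC, hCN, hCB⟩ := hcon N (A ∩ Q) (B ∩ Q) hNc (hA.inter hQc) (hB.inter hQc) hNW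
    (inter_subset_right.trans hQN) (inter_subset_right.trans hQN)
    (hAB.mono inter_subset_left inter_subset_left)
  refine ⟨C ∩ Q, ⟨hC.inter hQc, ?_⟩, fun y hy => ⟨hAC hy, hy.2⟩, fun y hy => ⟨hy.2, fun hyB =>
    disjoint_left.1 hCB hy.1 ⟨hyB, hy.2⟩⟩⟩
  have : C ∩ Q = Q \ (N \ C) := by
    ext y
    exact ⟨fun h => ⟨h.2, fun h' => h'.2 h.1⟩, fun h => ⟨by
      by_contra hn
      exact h.2 ⟨hQN h.1, hn⟩, h.1⟩⟩
  rw [this]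
  exact hQo.sdiff hC'

end CozeroKernel

/-! ### Star-finite shrinkings force a compact kernel -/

namespace CozeroKernel

variable {X : Type u} [TopologicalSpace X]

theorem IsStronglyParacompact.isParacompactHausdorff (h : IsStronglyParacompact X) :
    IsParacompactHausdorff X := by
  refine ⟨h.1, ⟨fun α s hs hc => ?_⟩⟩
  obtain ⟨𝒱, hV, hVr, hVf⟩ := h.2 (range s) ⟨by rintro _ ⟨a, rfl⟩; exact hs a, by
    rwa [sUnion_range]⟩
  refine ⟨𝒱, fun V => V, fun V => hV.1 V V.2, by rw [← sUnion_eq_iUnion]; exact hV.2, ?_, ?_⟩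
  · intro x
    obtain ⟨V, hVm, hx⟩ : x ∈ ⋃₀ 𝒱 := hV.2 ▸ mem_univ x
    exact ⟨V, (hV.1 V hVm).mem_nhds hx, hVf ⟨V, hVm⟩⟩
  · intro V
    obtain ⟨_, ⟨a, rfl⟩, ha⟩ := hVr V V.2
    exact ⟨a, ha⟩

theorem HasStarFiniteShrinkings.isStronglyParacompact [T2Space X]
    (h : HasStarFiniteShrinkings.{u, v} X) : IsStronglyParacompact X := by
  refine ⟨inferInstance, fun 𝒰 hU => ?_⟩
  obtain ⟨V, hVo, hVc, hVU, hVf⟩ := h (ULift.{max u v} 𝒰) (fun i => i.down)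
    (fun i => hU.1 _ i.down.2) (by
      refine iUnion_eq_univ_iff.2 fun x => ?_
      obtain ⟨U, hUm, hx⟩ : x ∈ ⋃₀ 𝒰 := hU.2 ▸ mem_univ x
      exact ⟨⟨U, hUm⟩, hx⟩)
  refine ⟨range V, ⟨?_, by rwa [sUnion_range]⟩, ?_, ?_⟩
  · rintro _ ⟨i, rfl⟩
    exact hVo i
  · rintro _ ⟨i, rfl⟩
    exact ⟨_, i.down.2, hVU i⟩
  · rintro ⟨_, i, rfl⟩
    refine ((hVf i).image fun j => (⟨V j, mem_range_self j⟩ : range V)).subset ?_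
    rintro ⟨_, j, rfl⟩ hj
    exact ⟨j, hj, rfl⟩

/-- A non-compact closed subset of a paracompact Hausdorff space contains a sequence of points with a
locally finite sequence of pairwise disjoint open neighbourhoods. -/
theorem exists_seq_locallyFinite_of_not_isCompact [T2Space X] [ParacompactSpace X] {K : Set X}
    (hKc : IsClosed K) (hK : ¬ IsCompact K) :
    ∃ (x : ℕ → X) (W : ℕ → Set X), (∀ n, x n ∈ K) ∧ (∀ n, IsOpen (W n)) ∧ (∀ n, x n ∈ W n) ∧
      LocallyFinite W ∧ Pairwise fun m n => Disjoint (W m) (W n) := by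
  have hnc : ∃ (ι : Type u) (U : ι → Set X), (∀ i, IsOpen (U i)) ∧ K ⊆ ⋃ i, U i ∧
      ∀ t : Finset ι, ¬ K ⊆ ⋃ i ∈ t, U i := by
    by_contra! hcon
    exact hK (isCompact_of_finite_subcover fun U hUo hKU => hcon _ U hUo hKU)
  obtain ⟨ι, U, hUo, hKU, hU⟩ := hnc
  obtain ⟨V, hVo, hKV, hVf, hVU⟩ := precise_refinement_set hKc U hUo hKU
  obtain ⟨f, hf, hf'⟩ := exists_seq_of_forall_finset_exists
    (fun a : X × Set X × ι => a.1 ∈ K ∧ IsOpen a.2.1 ∧ a.1 ∈ a.2.1 ∧ a.2.1 ⊆ V a.2.2 ∧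
      {i | (V i ∩ a.2.1).Nonempty}.Finite)
    (fun a b => Disjoint a.2.1 b.2.1 ∧ a.2.2 ≠ b.2.2) (by
      intro s hs
      have hfin : (⋃ a ∈ s, {i | (V i ∩ a.2.1).Nonempty}).Finite :=
        s.finite_toSet.biUnion fun a ha => (hs a ha).2.2.2.2
      -- The new point avoids every `U i` whose `V i` meets an earlier neighbourhood, so any `V j`
      -- containing it is disjoint from all earlier neighbourhoods.
      obtain ⟨x, hxK, hx⟩ := not_subset.1 (hU hfin.toFinset)
      obtain ⟨j, hj⟩ := mem_iUnion.1 (hKV hxK)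
      obtain ⟨N, hN, hNf⟩ := hVf x
      have hdis : ∀ a ∈ s, Disjoint a.2.1 (V j) := by
        intro a ha
        rw [disjoint_left]
        intro z hz hzV
        refine hx (mem_biUnion (x := j) ?_ (hVU j hj))
        exact hfin.mem_toFinset.2 (mem_biUnion ha ⟨z, hzV, hz⟩)
      refine ⟨(x, V j ∩ interior N, j), ⟨hxK, (hVo j).inter isOpen_interior,
        ⟨hj, mem_interior_iff_mem_nhds.2 hN⟩, inter_subset_left,
        hNf.subset fun i ⟨z, hz, hz'⟩ => ⟨z, hz, interior_subset hz'.2⟩⟩, fun a ha =>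
        ⟨(hdis a ha).mono_right inter_subset_left, ?_⟩⟩
      rintro rfl
      exact disjoint_left.1 (hdis a ha) (hs a ha).2.2.1 ((hs a ha).2.2.2.1 (hs a ha).2.2.1))
  have hinj : Function.Injective fun n => (f n).2.2 := by
    intro m n hmn
    by_contra hne
    rcases lt_or_gt_of_ne hne with hlt | hlt
    exacts [(hf' m n hlt).2 hmn, (hf' n m hlt).2 hmn.symm]
  refine ⟨fun n => (f n).1, fun n => (f n).2.1, fun n => (hf n).1, fun n => (hf n).2.1,
    fun n => (hf n).2.2.1, (hVf.comp_injective hinj).subset fun n => (hf n).2.2.2.1, ?_⟩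
  intro m n hne
  rcases lt_or_gt_of_ne hne with hlt | hlt
  exacts [(hf' m n hlt).1, (hf' n m hlt).1.symm]

theorem isClosed_cozeroKernel : IsClosed (cozeroKernel X) :=
  (isOpen_sUnion fun _ hU => hU.1).isClosed_compl

theorem HasStarFiniteShrinkings.isCompact_cozeroKernel [T2Space X] [ParacompactSpace X]
    (h : HasStarFiniteShrinkings.{u, v} X) : IsCompact (cozeroKernel X) := by
  by_contra hK
  obtain ⟨x, W, hxK, hWo, hxW, hWf, hWd⟩ := exists_seq_locallyFinite_of_not_isCompact isClosed_cozeroKernel hK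
  choose P A B hPc hA hB hPW hAP hBP hAB hP using
    fun n => exists_not_separated_of_mem_cozeroKernel (hxK n) (hWo n) (hxW n)
  -- Only the `n`-th member can contain points of `A n`, and only `none` can contain points of `B
  -- n`.
  let U : ULift.{max u v} (Option ℕ) → Set X := fun i => i.down.elim (⋃ n, A n)ᶜ fun n => W n \ B n
  have hAc : IsClosed (⋃ n, A n) :=
    (hWf.subset fun n => (hAP n).trans (hPW n)).isClosed_iUnion hA
  obtain ⟨V, hVo, hVc, hVU, hVf⟩ := h _ U
    (by
      rintro ⟨_ | n⟩
      exacts [hAc.isOpen_compl, (hWo n).sdiff (hB n)])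
    (by
      refine iUnion_eq_univ_iff.2 fun z => ?_
      by_cases hz : z ∈ ⋃ n, A n
      · obtain ⟨n, hn⟩ := mem_iUnion.1 hz
        exact ⟨⟨some n⟩, hPW n (hAP n hn), disjoint_left.1 (hAB n) hn⟩
      · exact ⟨⟨none⟩, hz⟩)
  -- By star-finiteness `V none` misses some `V n`; these two sets then split `P n` into relatively
  -- clopen pieces separating `A n` from `B n`.
  obtain ⟨n, hn⟩ := ((hVf ⟨none⟩).preimage (f := fun n : ℕ => (⟨some n⟩ : ULift (Option ℕ)))
    (fun a _ b _ hab => by simpa using hab)).exists_notMem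
  have hdis : Disjoint (V ⟨some n⟩) (V ⟨none⟩) := by
    rw [disjoint_iff_inter_eq_empty]
    exact not_nonempty_iff_eq_empty.1 hn
  have hPV : ∀ z ∈ P n, z ∈ V ⟨some n⟩ ∨ z ∈ V ⟨none⟩ := by
    intro z hz
    obtain ⟨⟨_ | m⟩, hm⟩ := iUnion_eq_univ_iff.1 hVc z
    · exact Or.inr hm
    · have hmn : m = n := by
        by_contra hne
        exact disjoint_left.1 (hWd hne) (hVU _ hm).1 (hPW n hz)
      exact Or.inl (hmn ▸ hm)
  have hdiff : P n ∩ V ⟨some n⟩ = P n \ V ⟨none⟩ := by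
    ext z
    exact ⟨fun hz => ⟨hz.1, disjoint_left.1 hdis hz.2⟩,
      fun hz => ⟨hz.1, (hPV z hz.1).resolve_right hz.2⟩⟩
  refine hP n (P n ∩ V ⟨some n⟩) ?_ ?_ ?_ inter_subset_left ?_
  · rw [hdiff]
    exact (hPc n).sdiff (hVo _)
  · have : P n \ (P n ∩ V ⟨some n⟩) = P n \ V ⟨some n⟩ := by
      ext z
      simp only [mem_sdiff, mem_inter_iff]
      tauto
    rw [this]
    exact (hPc n).sdiff (hVo _)
  · intro z hz
    exact ⟨hAP n hz, (hPV z (hAP n hz)).resolve_right fun hz' =>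
      hVU _ hz' (mem_iUnion.2 ⟨n, hz⟩)⟩
  · exact disjoint_left.2 fun z hz hzB => (hVU _ hz.2).2 hzB

end CozeroKernel

/-! ### Selections from a compact kernel -/

namespace CozeroKernel

open Filter Metric

variable {X : Type u} [TopologicalSpace X]

/-- Away from the cozero-dimensional kernel, open covers of a paracompact space have disjoint open
refinements. -/
theorem exists_disjoint_open_family [T2Space X] [ParacompactSpace X] {ι : Type*} {U : ι → Set X}
    (hU : ∀ i, IsOpen (U i)) (hUc : ⋃ i, U i = univ) {G : Set X} (hG : IsOpen G)
    (hKG : cozeroKernel X ⊆ G) :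
    ∃ D : ι → Set X, (∀ i, IsOpen (D i)) ∧ (∀ i, D i ⊆ U i) ∧
      (Pairwise fun i j => Disjoint (D i) (D j)) ∧ IsClopen (⋃ i, D i) ∧ (⋃ i, D i)ᶜ ⊆ G ∧
      cozeroKernel X ⊆ (⋃ i, D i)ᶜ := by
  choose Q hQ hxQ hQω hQs using fun x : omegaPart X => exists_isClopen_of_mem_omegaPart x.2
  obtain ⟨v, hvo, hGv, hvf, hvu⟩ := precise_refinement_set hG.isClosed_compl
    (fun a : ι × omegaPart X => U a.1 ∩ Q a.2) (fun a => (hU _).inter (hQ _).2) (by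
      intro x hx
      obtain ⟨i, hi⟩ := iUnion_eq_univ_iff.1 hUc x
      have hxω : x ∈ omegaPart X := by
        by_contra hn
        exact hx (hKG hn)
      exact mem_iUnion.2 ⟨(i, ⟨x, hxω⟩), hi, hxQ ⟨x, hxω⟩⟩)
  obtain ⟨F, hGF, hFc, hFv⟩ := exists_subset_iUnion_closed_subset hG.isClosed_compl hvo
    (fun x _ => hvf.point_finite x) hGv
  choose C hC hFC hCv using fun a => hQs a.2 (F a) (v a)ᶜ (hFc a) (hvo a).isClosed_compl
    (disjoint_compl_right_iff_subset.2 (hFv a))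
  have hFC' : ∀ a, F a ⊆ C a := fun a x hx => hFC a ⟨hx, (hvu a (hFv a hx)).2⟩
  have hCv' : ∀ a, C a ⊆ v a := fun a x hx => not_not.1 (hCv a hx).2
  have hCf : LocallyFinite C := hvf.subset hCv'
  obtain ⟨_, _⟩ := exists_wellFoundedLT (ι × omegaPart X)
  -- Subtracting all earlier sets in a well-order makes the family disjoint; local finiteness keeps
  -- each difference clopen.
  let C' : ι × omegaPart X → Set X := fun a => C a \ ⋃ b : Iio a, C b
  have hC'C : ∀ a, C' a ⊆ C a := fun a => sdiff_subset
  have hC' : ∀ a, IsClopen (C' a) := fun a => (hC a).diff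
    ⟨(hCf.comp_injective Subtype.val_injective).isClosed_iUnion fun b => (hC b).1,
      isOpen_iUnion fun b => (hC b).2⟩
  have hlt : ∀ a b, a < b → Disjoint (C' a) (C' b) := fun a b hab =>
    disjoint_left.2 fun x ha hb => hb.2 (mem_iUnion.2 ⟨⟨a, hab⟩, ha.1⟩)
  have hne : ∀ a b, a ≠ b → Disjoint (C' a) (C' b) := fun a b hab =>
    (lt_or_gt_of_ne hab).elim (hlt a b) fun h => (hlt b a h).symm
  have hcov : Gᶜ ⊆ ⋃ a, C' a := by
    intro x hx
    obtain ⟨a, ha⟩ := mem_iUnion.1 (hGF hx)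
    have hx' : {a | x ∈ C a}.Nonempty := ⟨a, hFC' a ha⟩
    refine mem_iUnion.2 ⟨wellFounded_lt.min _ hx', wellFounded_lt.min_mem _ hx', ?_⟩
    rintro hn
    obtain ⟨⟨b, hb⟩, hxb⟩ := mem_iUnion.1 hn
    exact wellFounded_lt.not_lt_min {a | x ∈ C a} hxb hb
  have hD : ⋃ i, ⋃ x, C' (i, x) = ⋃ a, C' a := (iUnion_prod' C').symm
  refine ⟨fun i => ⋃ x, C' (i, x), fun i => isOpen_iUnion fun x => (hC' _).2,
    fun i => iUnion_subset fun x => ((hC'C _).trans (hCv' _)).trans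
      ((hvu _).trans inter_subset_left), ?_, ?_, ?_, ?_⟩
  · intro i j hij
    simp only [disjoint_iUnion_left, disjoint_iUnion_right]
    exact fun x y => hne _ _ fun h => hij (Prod.ext_iff.1 h).1
  · rw [hD]
    exact ⟨(hCf.subset hC'C).isClosed_iUnion fun a => (hC' a).1,
      isOpen_iUnion fun a => (hC' a).2⟩
  · rw [hD]
    exact compl_subset_comm.1 hcov
  · rw [hD]
    intro x hx hx'
    obtain ⟨a, ha⟩ := mem_iUnion.1 hx'
    exact hx (hQω _ (hvu a (hCv' a (hC'C a ha))).2)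

/-- A paracompact space with compact cozero-dimensional kernel has, for each open cover, finite-valued
index maps `J₀ ⊆ J`, with open and closed fibres respectively, that involve finitely many indices
on a clopen neighbourhood of the kernel and are locally constant elsewhere. -/
theorem exists_finset_selection [T2Space X] [ParacompactSpace X]
    (hK : IsCompact (cozeroKernel X)) {ι : Type*} {U : ι → Set X}
    (hU : ∀ i, IsOpen (U i)) (hUc : ⋃ i, U i = univ) {E : Set X} (hE : IsClopen E)
    (hKE : cozeroKernel X ⊆ E) :
    ∃ (J₀ J : X → Finset ι) (E' : Set X), IsClopen E' ∧ cozeroKernel X ⊆ E' ∧ E' ⊆ E ∧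
      (∀ x, (J₀ x).Nonempty) ∧ (∀ x, J₀ x ⊆ J x) ∧ (∀ x, ∀ i ∈ J x, x ∈ U i) ∧
      (∀ x, ∀ᶠ z in 𝓝 x, J₀ x ⊆ J₀ z ∧ J z ⊆ J x) ∧
      (⋃ x ∈ E', (J x : Set ι)).Finite ∧ ∀ x ∉ E', ∃ i, J x = {i} := by
  classical
  obtain ⟨I, hI⟩ := hK.elim_finite_subcover U hU (hUc ▸ subset_univ _)
  obtain ⟨D, hDo, hDU, hDd, hDc, hDG, hKD⟩ := exists_disjoint_open_family hU hUc
    (G := E ∩ ⋃ i ∈ I, U i) (hE.2.inter (isOpen_biUnion fun i _ => hU i)) (subset_inter hKE hI)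
  -- Near the kernel, membership in the open `A i` defines `J₀` and membership in its closure
  -- defines `J`. The union over `i ∈ I` empties the members with index outside `I`.
  obtain ⟨A, hA, hAo, hAU⟩ := exists_subset_iUnion_closure_subset (s := (⋃ i, D i)ᶜ)
    (u := fun i => ⋃ _ : i ∈ I, U i) hDc.2.isClosed_compl
    (fun i => isOpen_iUnion fun _ => hU i)
    (fun x _ => I.finite_toSet.subset fun i hi => (mem_iUnion.1 hi).1)
    (hDG.trans inter_subset_right)
  -- Off `⋃ i, D i` the chosen index is a dummy value.
  have hch : ∀ x, ∃ i, x ∈ ⋃ i, D i → x ∈ D i := fun x => by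
    by_cases hx : x ∈ ⋃ i, D i
    · exact (mem_iUnion.1 hx).imp fun i hi _ => hi
    · exact (iUnion_eq_univ_iff.1 hUc x).imp fun i _ h => (hx h).elim
  choose k hk using hch
  let J (B : ι → Set X) : X → Finset ι := fun x =>
    if x ∈ ⋃ i, D i then {k x} else I.filter fun i => x ∈ B i
  have hJD : ∀ B x, x ∈ ⋃ i, D i → J B x = {k x} := fun B x hx => if_pos hx
  have hJA : ∀ B x, x ∉ ⋃ i, D i → J B x = I.filter fun i => x ∈ B i := fun B x hx => if_neg hx
  refine ⟨J A, J fun i => closure (A i), (⋃ i, D i)ᶜ, hDc.compl, hKD,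
    hDG.trans inter_subset_left, ?_, ?_, ?_, ?_, ?_, ?_⟩
  · intro x
    by_cases hx : x ∈ ⋃ i, D i
    · simp [hJD _ x hx]
    · obtain ⟨i, hi⟩ := mem_iUnion.1 (hA hx)
      rw [hJA _ x hx]
      exact ⟨i, Finset.mem_filter.2 ⟨(mem_iUnion.1 (hAU i (subset_closure hi))).1, hi⟩⟩
  · intro x
    by_cases hx : x ∈ ⋃ i, D i
    · rw [hJD _ x hx, hJD _ x hx]
    · rw [hJA _ x hx, hJA _ x hx]
      exact Finset.monotone_filter_right _ fun i _ hi => subset_closure hi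
  · intro x i hi
    by_cases hx : x ∈ ⋃ i, D i
    · rw [hJD _ x hx, Finset.mem_singleton] at hi
      exact hi ▸ hDU _ (hk x hx)
    · rw [hJA _ x hx, Finset.mem_filter] at hi
      exact (mem_iUnion.1 (hAU i hi.2)).2
  · intro x
    by_cases hx : x ∈ ⋃ i, D i
    · filter_upwards [(hDo _).mem_nhds (hk x hx)] with z hz
      have hz' : z ∈ ⋃ i, D i := mem_iUnion.2 ⟨_, hz⟩
      have hkz : k z = k x := by
        by_contra hne
        exact disjoint_left.1 (hDd hne) (hk z hz') hz
      simp [hJD _ x hx, hJD _ z hz', hkz]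
    · have hev : ∀ᶠ z in 𝓝 x, ∀ i ∈ I, (x ∈ A i → z ∈ A i) ∧
          (z ∈ closure (A i) → x ∈ closure (A i)) := by
        refine (Filter.eventually_all_finset I).2 fun i _ => Filter.Eventually.and ?_ ?_
        · by_cases hi : x ∈ A i
          · filter_upwards [(hAo i).mem_nhds hi] with z hz _ using hz
          · exact Eventually.of_forall fun _ h => (hi h).elim
        · by_cases hi : x ∈ closure (A i)
          · exact Eventually.of_forall fun _ _ => hi
          · filter_upwards [isClosed_closure.isOpen_compl.mem_nhds hi] with z hz hz'
            exact (hz hz').elim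
      filter_upwards [hDc.1.isOpen_compl.mem_nhds hx, hev] with z hz hz'
      rw [hJA _ x hx, hJA _ z hz, hJA _ x hx, hJA _ z hz]
      constructor <;> intro i hi <;> rw [Finset.mem_filter] at hi ⊢
      · exact ⟨hi.1, (hz' i hi.1).1 hi.2⟩
      · exact ⟨hi.1, (hz' i hi.1).2 hi.2⟩
  · refine I.finite_toSet.subset (iUnion₂_subset fun x hx i hi => ?_)
    rw [hJA _ x hx] at hi
    exact (Finset.mem_filter.1 hi).1
  · intro x hx
    exact ⟨k x, hJD _ x (not_not.1 hx)⟩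

/-- Finite-valued maps `g ⊆ f`, with open and closed fibres respectively, which approximate `θ` up
to `ε`, such that `f` takes finitely many values on the clopen set `E ⊇ cω(X)` and is single-valued
off `E`. -/
structure IsApproxSelection {Y : Type*} [MetricSpace Y] (θ : X → Set Y) (ε : ℝ)
    (g f : X → Finset Y) (E : Set X) : Prop where
  isClopen : IsClopen E
  kernel_subset : cozeroKernel X ⊆ E
  nonempty : ∀ x, (g x).Nonempty
  subset : ∀ x, g x ⊆ f x
  eventually_subset : ∀ x, ∀ᶠ z in 𝓝 x, g x ⊆ g z ∧ f z ⊆ f x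
  near : ∀ x, ∀ y ∈ f x, ∃ y' ∈ θ x, dist y y' < ε
  finite : (⋃ x ∈ E, (f x : Set Y)).Finite
  singleton : ∀ x ∉ E, ∃ y, f x = {y}

/-- The cover is indexed by the points of `X`, and index `x` contributes the value `w x`. The sets
`O x` are a free parameter through which the recursion imposes closeness to the previous
approximation. -/
theorem exists_isApproxSelection [T2Space X] [ParacompactSpace X]
    (hK : IsCompact (cozeroKernel X)) {Y : Type*} [MetricSpace Y] {θ : X → Set Y}
    (hθ : LowerHemicontinuous θ) {E : Set X} (hE : IsClopen E) (hKE : cozeroKernel X ⊆ E)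
    {w : X → Y} (hw : ∀ x, w x ∈ θ x) {O : X → Set X} (hO : ∀ x, IsOpen (O x))
    (hxO : ∀ x, x ∈ O x) {ε : ℝ} (hε : 0 < ε) :
    ∃ (g f : X → Finset Y) (E' : Set X), IsApproxSelection θ ε g f E' ∧ E' ⊆ E ∧
      ∀ z, ∀ y ∈ f z, ∃ x, z ∈ O x ∧ y = w x := by
  classical
  obtain ⟨J₀, J, E', hE', hKE', hEE', hJn, hJJ, hJN, hJs, hJf, hJ1⟩ :=
    exists_finset_selection hK (U := fun x => O x ∩ {z | (θ z ∩ ball (w x) ε).Nonempty})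
    (fun x => (hO x).inter (lowerHemicontinuous_iff_isOpen_inter_nonempty.1 hθ _ isOpen_ball))
    (iUnion_eq_univ_iff.2 fun x => ⟨x, hxO x, w x, hw x, mem_ball_self hε⟩) hE hKE
  refine ⟨fun z => (J₀ z).image w, fun z => (J z).image w, E', ⟨hE', hKE', fun x => (hJn x).image w,
    fun x => Finset.image_subset_image (hJJ x), ?_, ?_, ?_, ?_⟩, hEE', ?_⟩
  · intro x
    filter_upwards [hJs x] with z hz
    exact ⟨Finset.image_subset_image hz.1, Finset.image_subset_image hz.2⟩
  · intro z y hy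
    obtain ⟨x, hx, rfl⟩ := Finset.mem_image.1 hy
    obtain ⟨y, hy, hyw⟩ := (hJN z x hx).2
    exact ⟨y, hy, by rwa [dist_comm]⟩
  · refine (hJf.image w).subset (iUnion₂_subset fun z hz y hy => ?_)
    obtain ⟨x, hx, rfl⟩ := Finset.mem_image.1 (Finset.mem_coe.1 hy)
    exact mem_image_of_mem _ (mem_biUnion hz hx)
  · intro x hx
    obtain ⟨i, hi⟩ := hJ1 x hx
    exact ⟨w i, by simp [hi]⟩
  · intro z y hy
    obtain ⟨x, hx, rfl⟩ := Finset.mem_image.1 hy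
    exact ⟨x, (hJN z x hx).1, rfl⟩

/-- This is why two maps `g ⊆ f` are carried along: the open fibres of `g` make `{z | t x ∈ g z}` a
legitimate `O x`, while the closed fibres of `f` give upper semi-continuity of the limit. -/
theorem IsApproxSelection.exists_next [T2Space X] [ParacompactSpace X]
    (hK : IsCompact (cozeroKernel X)) {Y : Type*} [MetricSpace Y] {θ : X → Set Y}
    (hθ : LowerHemicontinuous θ) {ε ε' : ℝ} (hε' : 0 < ε') {g f : X → Finset Y} {E : Set X}
    (h : IsApproxSelection θ ε g f E) :
    ∃ (g' f' : X → Finset Y) (E' : Set X), IsApproxSelection θ ε' g' f' E' ∧ E' ⊆ E ∧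
      ∀ z, ∀ y ∈ f' z, ∃ t ∈ f z, dist y t < ε := by
  choose t ht using h.nonempty
  choose w hw htw using fun x => h.near x (t x) (h.subset x (ht x))
  obtain ⟨g', f', E', h', hEE', hf'⟩ := exists_isApproxSelection hK hθ h.isClopen h.kernel_subset
    hw (O := fun x => {z | t x ∈ g z}) (fun x => isOpen_iff_eventually.2 fun z hz =>
      (h.eventually_subset z).mono fun a ha => ha.1 hz) ht hε'
  refine ⟨g', f', E', h', hEE', fun z y hy => ?_⟩
  obtain ⟨x, hx, rfl⟩ := hf' z y hy
  exact ⟨t x, h.subset z hx, by rw [dist_comm]; exact htw x⟩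

theorem exists_seq_isApproxSelection [T2Space X] [ParacompactSpace X]
    (hK : IsCompact (cozeroKernel X)) {Y : Type*} [MetricSpace Y] {θ : X → Set Y}
    (hθn : IsSetValuedMap θ) (hθ : LowerHemicontinuous θ) {ε : ℕ → ℝ} (hε : ∀ n, 0 < ε n) :
    ∃ (g f : ℕ → X → Finset Y) (E : ℕ → Set X), (∀ n, IsApproxSelection θ (ε n) (g n) (f n) (E n)) ∧
      Antitone E ∧ ∀ n z, ∀ y ∈ f (n + 1) z, ∃ t ∈ f n z, dist y t < ε n := by
  choose w hw using hθn
  obtain ⟨g₀, f₀, E₀, h₀, -, -⟩ := exists_isApproxSelection hK hθ isClopen_univ (subset_univ _) hw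
    (fun _ => isOpen_univ) (fun _ => mem_univ _) (hε 0)
  let S : ℕ → Type _ := fun n => {p : (X → Finset Y) × (X → Finset Y) × Set X //
    IsApproxSelection θ (ε n) p.1 p.2.1 p.2.2}
  have hnext : ∀ n (p : S n), ∃ q : S (n + 1), q.1.2.2 ⊆ p.1.2.2 ∧
      ∀ z, ∀ y ∈ q.1.2.1 z, ∃ t ∈ p.1.2.1 z, dist y t < ε n := by
    rintro n ⟨p, hp⟩
    obtain ⟨g', f', E', h', hEE', hf'⟩ := hp.exists_next hK hθ (hε (n + 1))
    exact ⟨⟨(g', f', E'), h'⟩, hEE', hf'⟩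
  choose next hnE hnf using hnext
  let F : ∀ n, S n := Nat.rec ⟨(g₀, f₀, E₀), h₀⟩ next
  exact ⟨fun n => (F n).1.1, fun n => (F n).1.2.1, fun n => (F n).1.2.2, fun n => (F n).2,
    antitone_nat_of_succ_le fun n => hnE n (F n), fun n => hnf n (F n)⟩

/-- Kuratowski-type property of a decreasing sequence of closed neighbourhoods of finite sets. -/
theorem exists_mem_of_closedBall_finset {Y : Type*} [MetricSpace Y] [CompleteSpace Y]
    {f : ℕ → Finset Y} {δ : ℕ → ℝ} (hδ : Tendsto δ atTop (𝓝 0)) {C : ℕ → Set Y}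
    (hC : ∀ n, C n = ⋃ t ∈ f n, closedBall t (δ n)) (hCa : Antitone C) {F : Set Y}
    (hF : IsClosed F) (hne : ∀ n, (C n ∩ F).Nonempty) : ((⋂ n, C n) ∩ F).Nonempty := by
  have hCc : ∀ n, IsClosed (C n) := fun n => by
    rw [hC]
    exact (f n).finite_toSet.isClosed_biUnion fun t _ => isClosed_closedBall
  -- Any choice of points `y n ∈ C n ∩ F` has totally bounded range, and a cluster point lies in
  -- every `C n`.
  choose y hy using hne
  have htb : TotallyBounded (range y) := by
    refine totallyBounded_iff.2 fun ε hε => ?_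
    obtain ⟨n, hn⟩ := (hδ.eventually (gt_mem_nhds hε)).exists
    refine ⟨f n ∪ y '' Iio n, (f n).finite_toSet.union ((finite_Iio n).image y), ?_⟩
    rintro _ ⟨m, rfl⟩
    rcases lt_or_ge m n with hm | hm
    · exact mem_biUnion (Or.inr (mem_image_of_mem y hm)) (mem_ball_self hε)
    · have := hCa hm (hy m).1
      rw [hC] at this
      obtain ⟨t, ht, hyt⟩ := mem_iUnion₂.1 this
      exact mem_biUnion (Or.inl ht) (lt_of_le_of_lt hyt hn)
  obtain ⟨a, -, φ, hφ, ha⟩ := (htb.closure.isCompact_of_isClosed isClosed_closure).tendsto_subseq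
    fun n => subset_closure (mem_range_self n)
  refine ⟨a, mem_iInter.2 fun n => ?_, hF.mem_of_tendsto ha (Eventually.of_forall fun k => (hy _).2)⟩
  refine (hCc n).mem_of_tendsto ha ?_
  filter_upwards [hφ.tendsto_atTop.eventually_ge_atTop n] with k hk
  exact hCa hk (hy _).1

theorem hasKernelSelections_of_isCompact [T2Space X] [ParacompactSpace X]
    (hK : IsCompact (cozeroKernel X)) : HasKernelSelections.{u, v} X := by
  intro Y _ _ θ hθn hθ hθc
  -- The tail sum of the errors `1 / 2 ^ k`, `k ≥ n`; the identity `δ (n + 1) + 1 / 2 ^ n = δ n`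
  -- makes `C x` decreasing.
  let δ : ℕ → ℝ := fun n => 2 / 2 ^ n
  obtain ⟨g, f, E, h, hEa, hff⟩ := exists_seq_isApproxSelection hK hθn hθ
    (ε := fun n => 1 / 2 ^ n) (fun n => by positivity)
  have hδ0 : ∀ n, 0 < δ n := fun n => by positivity
  have hδ : Tendsto δ atTop (𝓝 0) := by
    have := (tendsto_pow_atTop_nhds_zero_of_lt_one (r := (1 / 2 : ℝ)) (by norm_num)
      (by norm_num)).const_mul 2
    simpa [δ, div_eq_mul_inv] using this
  let C : X → ℕ → Set Y := fun x n => ⋃ t ∈ f n x, closedBall t (δ n)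
  have hmC : ∀ x n y, y ∈ C x n ↔ ∃ t ∈ f n x, dist y t ≤ δ n := fun x n y => by simp [C]
  have hCa : ∀ x, Antitone (C x) := fun x => antitone_nat_of_succ_le fun n y hy => by
    obtain ⟨t, ht, hyt⟩ := (hmC _ _ _).1 hy
    obtain ⟨s, hs, hts⟩ := hff n x t ht
    refine (hmC _ _ _).2 ⟨s, hs, (dist_triangle y t s).trans ?_⟩
    have : δ (n + 1) + 1 / 2 ^ n = δ n := by
      simp only [δ, pow_succ]
      field_simp
      norm_num
    rw [← this]
    exact add_le_add hyt hts.le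
  have hCc : ∀ x n, IsClosed (C x n) := fun x n =>
    (f n x).finite_toSet.isClosed_biUnion fun t _ => isClosed_closedBall
  have hsmall : ∀ ε : ℝ, 0 < ε → ∃ n, δ n < ε := fun ε hε =>
    (hδ.eventually (gt_mem_nhds hε)).exists
  have hψne : ∀ x, (⋂ n, C x n).Nonempty := fun x =>
    (exists_mem_of_closedBall_finset hδ (fun _ => rfl) (hCa x) isClosed_univ fun n => by
      obtain ⟨y, hy⟩ := (h n).nonempty x
      exact ⟨y, (hmC _ _ _).2 ⟨y, (h n).subset x hy, by simpa using (hδ0 n).le⟩, mem_univ _⟩).mono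
      inter_subset_left
  have htb : ∀ S : Set X, (∀ n, (⋃ x ∈ S, (f n x : Set Y)).Finite) →
      TotallyBounded (⋃ x ∈ S, ⋂ n, C x n) := by
    intro S hS
    refine totallyBounded_iff.2 fun ε hε => ?_
    obtain ⟨n, hn⟩ := hsmall ε hε
    refine ⟨_, hS n, iUnion₂_subset fun x hx y hy => ?_⟩
    obtain ⟨t, ht, hyt⟩ := (hmC _ _ _).1 (mem_iInter.1 hy n)
    exact mem_biUnion (mem_biUnion hx ht) (lt_of_le_of_lt hyt hn)
  refine ⟨fun x => ⋂ n, C x n, ⋂ n, E n, ⟨hψne, fun x y hy => ?_⟩, ?_, fun x => ?_,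
    isClosed_iInter fun n => (h n).isClopen.1,
    IsGδ.iInter_of_isOpen fun n => (h n).isClopen.2,
    subset_iInter fun n => (h n).kernel_subset, ?_, fun x hx => ?_⟩
  · rw [← (hθc x).closure_eq, Metric.mem_closure_iff]
    intro ε hε
    obtain ⟨n, hn⟩ := hsmall (ε / 2) (half_pos hε)
    obtain ⟨t, ht, hyt⟩ := (hmC _ _ _).1 (mem_iInter.1 hy n)
    obtain ⟨s, hs, hts⟩ := (h n).near x t ht
    refine ⟨s, hs, ?_⟩
    have h1 : (1 : ℝ) / 2 ^ n ≤ δ n := by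
      simp only [δ]
      gcongr
      norm_num
    linarith [dist_triangle y t s]
  · rw [upperHemicontinuous_iff_forall_isOpen]
    intro x V hV hxV
    -- By compactness a single stage already lies in `V`, and that stage can only shrink at nearby
    -- points.
    obtain ⟨n, hn⟩ : ∃ n, C x n ⊆ V := by
      by_contra! hcon
      obtain ⟨y, hy, hyV⟩ := exists_mem_of_closedBall_finset hδ (fun _ => rfl) (hCa x)
        hV.isClosed_compl fun n => not_subset.1 (hcon n)
      exact hyV (hxV hy)
    filter_upwards [(h n).eventually_subset x] with z hz
    exact ((iInter_subset _ n).trans (biUnion_subset_biUnion_left hz.2)).trans hn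
  · have := htb {x} fun n => by simp
    rw [biUnion_singleton] at this
    exact this.isCompact_of_isClosed (isClosed_iInter (hCc x))
  · exact (htb (⋂ n, E n) fun n => (h n).finite.subset
      (biUnion_subset_biUnion_left (iInter_subset _ n))).closure.isCompact_of_isClosed
      isClosed_closure
  · obtain ⟨n, hn⟩ : ∃ n, x ∉ E n := by simpa using hx
    obtain ⟨y, hy⟩ := hψne x
    refine ⟨y, (eq_singleton_iff_unique_mem.2 ⟨hy, fun z hz => ?_⟩)⟩
    refine eq_of_forall_dist_le fun ε hε => ?_
    obtain ⟨m, hm⟩ := eventually_atTop.1 (hδ.eventually (gt_mem_nhds (half_pos hε)))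
    -- From stage `n` on, `x` stays outside the decreasing sets `E`, so `ψ x` lies in single balls
    -- of radius tending to `0`.
    obtain ⟨p, hp⟩ := (h (max m n)).singleton x fun hx => hn (hEa (le_max_right m n) hx)
    obtain ⟨t, ht, hyt⟩ := (hmC _ _ _).1 (mem_iInter.1 hy (max m n))
    obtain ⟨s, hs, hzs⟩ := (hmC _ _ _).1 (mem_iInter.1 hz (max m n))
    rw [hp, Finset.mem_singleton] at ht hs
    subst ht hs
    linarith [dist_triangle_right z y s, hm _ (le_max_left m n)]

end CozeroKernel

/-! ### Largest images and star-finite shrinkings -/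

namespace CozeroKernel

section Saturation

variable {X : Type u} {Y : Type v} {ψ : X → Set Y}

/-- `S` contains every value of `ψ` that it meets. -/
def IsSaturated (ψ : X → Set Y) (S : Set Y) : Prop := ∀ x, (ψ x ∩ S).Nonempty → ψ x ⊆ S

theorem isSaturated_largestImage (A : Set X) : IsSaturated ψ (largestImage ψ A) := by
  rintro x ⟨y, hy, hyA⟩ z hz
  obtain ⟨n, hn⟩ := mem_iUnion.1 hyA
  exact mem_iUnion.2 ⟨n + 1, mem_biUnion (show x ∈ invImage ψ (iterImage ψ A n) from ⟨y, hy, hn⟩) hz⟩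

theorem subset_largestImage (x : X) : ψ x ⊆ largestImage ψ {x} := fun _ hy =>
  mem_iUnion.2 ⟨0, mem_biUnion (mem_singleton x) hy⟩

theorem IsSaturated.largestImage_subset {S : Set Y} (hS : IsSaturated ψ S) {x : X}
    (hx : ψ x ⊆ S) : largestImage ψ {x} ⊆ S := by
  refine iUnion_subset fun n => ?_
  induction n with
  | zero =>
    refine iUnion₂_subset fun z hz => ?_
    rw [mem_singleton_iff.1 hz]
    exact hx
  | succ n ih => exact iUnion₂_subset fun z hz => hS z (hz.mono (inter_subset_inter_right _ ih))

/-- A chain of overlapping values from `ψ x` to `y` can be walked backwards inside `S`. This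
symmetry makes largest images that meet coincide. -/
theorem IsSaturated.inter_nonempty {S : Set Y} (hS : IsSaturated ψ S) {x : X} {y : Y}
    (hy : y ∈ largestImage ψ {x}) (hyS : y ∈ S) : (ψ x ∩ S).Nonempty := by
  obtain ⟨n, hn⟩ := mem_iUnion.1 hy
  induction n generalizing y with
  | zero =>
    obtain ⟨z, hz, hyz⟩ := mem_iUnion₂.1 hn
    rw [mem_singleton_iff.1 hz] at hyz
    exact ⟨y, hyz, hyS⟩
  | succ n ih =>
    obtain ⟨z, ⟨w, hwz, hw⟩, hyz⟩ := mem_iUnion₂.1 hn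
    exact ih (mem_iUnion.2 ⟨n, hw⟩) (hS z ⟨y, hyz, hyS⟩ hwz) hw

theorem largestImage_subset_of_mem {x x' : X} {y : Y} (hy : y ∈ largestImage ψ {x})
    (hy' : y ∈ largestImage ψ {x'}) : largestImage ψ {x} ⊆ largestImage ψ {x'} :=
  (isSaturated_largestImage _).largestImage_subset
    (isSaturated_largestImage _ x ((isSaturated_largestImage _).inter_nonempty hy hy'))

end Saturation

variable {X : Type u} [TopologicalSpace X]

theorem HasKernelSelections.hasCompactLargestImageSelections (h : HasKernelSelections.{u, v} X) :
    HasCompactLargestImageSelections.{u, v} X := by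
  intro Y _ _ θ hθn hθ hθc
  obtain ⟨ψ, H, hψ, hψu, -, -, -, -, hH, hψ1⟩ := h Y θ hθn hθ hθc
  refine ⟨ψ, hψ, hψu, fun x => ?_⟩
  have hmem : ∀ z ∈ H, ψ z ⊆ image ψ H := fun z hz => subset_biUnion_of_mem hz
  -- A value taken off `H` is a point, so it cannot link `ψ(H)` to anything outside it.
  have hsat : IsSaturated ψ (image ψ H) := by
    rintro z ⟨y, hy, hyH⟩
    by_cases hz : z ∈ H
    · exact hmem z hz
    · obtain ⟨a, ha⟩ := hψ1 z hz
      rw [ha, mem_singleton_iff] at hy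
      rw [ha, singleton_subset_iff]
      exact hy ▸ hyH
  by_cases hx : (ψ x ∩ image ψ H).Nonempty
  · exact hH.of_isClosed_subset isClosed_closure
      (closure_mono (hsat.largestImage_subset (hsat x hx)))
  · have hxH : x ∉ H := fun hxH => hx ((hψ.1 x).mono (subset_inter Subset.rfl (hmem x hxH)))
    obtain ⟨y, hy⟩ := hψ1 x hxH
    have hyH : y ∉ image ψ H := fun hyH => hx ⟨y, by rw [hy]; rfl, hyH⟩
    have hs : IsSaturated ψ {y} := by
      rintro z ⟨w, hw, rfl⟩
      obtain ⟨a, ha⟩ := hψ1 z fun hz => hyH (hmem z hz hw)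
      rw [ha, mem_singleton_iff] at hw
      rw [ha, hw]
    refine (isCompact_singleton (x := y)).of_isClosed_subset isClosed_closure ?_
    exact closure_minimal (hs.largestImage_subset hy.subset) isClosed_singleton

theorem HasCompactLargestImageSelections.hasFiniteLargestImageSelections
    (h : HasCompactLargestImageSelections.{u, v} X) : HasFiniteLargestImageSelections.{u, v} X := by
  intro Y _ _ θ hθn hθ
  let := TopologicalSpace.upgradeIsCompletelyMetrizable Y
  obtain ⟨ψ, hψ, hψu, hψc⟩ := h Y θ hθn hθ fun x => isClosed_discrete _
  exact ⟨ψ, hψ, hψu, fun x => (hψc x).finite_of_discrete.subset subset_closure⟩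

theorem lowerHemicontinuous_setOf_mem {ι : Type*} [TopologicalSpace ι] {U : ι → Set X}
    (hU : ∀ i, IsOpen (U i)) : LowerHemicontinuous fun x => {i | x ∈ U i} := by
  rw [lowerHemicontinuous_iff_isOpen_inter_nonempty]
  intro B _
  have : {x | ({i | x ∈ U i} ∩ B).Nonempty} = ⋃ i ∈ B, U i := by
    ext x
    simp [Set.Nonempty, and_comm]
  rw [this]
  exact isOpen_biUnion fun i _ => hU i

theorem HasFiniteLargestImageSelections.hasStarFiniteShrinkings
    (h : HasFiniteLargestImageSelections.{u, v} X) : HasStarFiniteShrinkings.{u, v} X := by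
  intro ι U hU hUc
  let : TopologicalSpace ι := ⊥
  have : DiscreteTopology ι := ⟨rfl⟩
  obtain ⟨ψ, hψ, hψu, hψf⟩ := h ι (fun x => {i | x ∈ U i}) (iUnion_eq_univ_iff.1 hUc)
    (lowerHemicontinuous_setOf_mem hU)
  refine ⟨fun i => U i ∩ {x | i ∈ largestImage ψ {x}}, fun i => (hU i).inter ?_, ?_,
    fun i => inter_subset_left, fun i => ?_⟩
  · refine isOpen_iff_eventually.2 fun x hx => ?_
    -- In a discrete range `ψ x` is open, so `ψ z ⊆ ψ x` for `z` near `x`, and the two points have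
    -- the same largest image.
    filter_upwards [upperHemicontinuous_iff_forall_isOpen.1 hψu x (ψ x) (isOpen_discrete _)
      Subset.rfl] with z hz
    obtain ⟨j, hj⟩ := hψ.1 z
    exact largestImage_subset_of_mem (subset_largestImage x (hz hj)) (subset_largestImage z hj) hx
  · refine iUnion_eq_univ_iff.2 fun x => ?_
    obtain ⟨i, hi⟩ := hψ.1 x
    exact ⟨i, hψ.2 x hi, subset_largestImage x hi⟩
  · by_cases hi : ∃ x, i ∈ largestImage ψ {x}
    · obtain ⟨x, hx⟩ := hi
      refine (hψf x).subset ?_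
      rintro j ⟨z, hzj, hzi⟩
      exact largestImage_subset_of_mem hzi.2 hx hzj.2
    · refine finite_empty.subset ?_
      rintro j ⟨z, -, hzi⟩
      exact hi ⟨z, hzi.2⟩

theorem HasFiniteLargestImageSelections.t2Space [T1Space X]
    (h : HasFiniteLargestImageSelections.{u, v} X) : T2Space X := by
  refine ⟨fun x y hxy => ?_⟩
  let : TopologicalSpace (ULift.{max u v} Bool) := ⊥
  have : DiscreteTopology (ULift.{max u v} Bool) := ⟨rfl⟩
  -- The index is forced to be `false` at `x` and `true` at `y`; the open sets where `ψ` is confined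
  -- to one index separate the points.
  let U : ULift.{max u v} Bool → Set X := fun b => if b.down then {x}ᶜ else {y}ᶜ
  obtain ⟨ψ, hψ, hψu, -⟩ := h _ (fun z => {b | z ∈ U b}) (fun z => by
      by_cases hz : z = x
      · exact ⟨⟨false⟩, by simpa [U, hz] using hxy⟩
      · exact ⟨⟨true⟩, by simpa [U] using hz⟩)
    (lowerHemicontinuous_setOf_mem fun b => by
      dsimp only [U]
      split_ifs <;> exact isOpen_compl_singleton)
  have hopen : ∀ b, IsOpen {z | ψ z ⊆ {b}} := fun b =>
    isOpen_iff_eventually.2 fun z hz =>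
      upperHemicontinuous_iff_forall_isOpen.1 hψu z {b} (isOpen_discrete _) hz
  refine ⟨_, _, hopen ⟨false⟩, hopen ⟨true⟩, ?_, ?_, ?_⟩
  · rintro ⟨_ | _⟩ hb
    · rfl
    · exact (hψ.2 x hb rfl).elim
  · rintro ⟨_ | _⟩ hb
    · exact (hψ.2 y hb rfl).elim
    · rfl
  · refine disjoint_left.2 fun z hz hz' => ?_
    obtain ⟨b, hb⟩ := hψ.1 z
    have := (hz hb).symm.trans (hz' hb)
    simp at this

end CozeroKernel

theorem corollary3p3 (X : Type u) [TopologicalSpace X] [T1Space X] :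
    List.TFAE
      [CozeroKernel.IsParacompactHausdorff X ∧ IsCompact (CozeroKernel.cozeroKernel X),
       CozeroKernel.IsStronglyParacompact X ∧ IsCompact (CozeroKernel.cozeroKernel X),
       CozeroKernel.HasKernelSelections.{u, v} X,
       CozeroKernel.HasCompactLargestImageSelections.{u, v} X,
       CozeroKernel.HasFiniteLargestImageSelections.{u, v} X,
       T2Space X ∧ CozeroKernel.HasStarFiniteShrinkings.{u, v} X] := by
  tfae_have 2 → 1 := fun h => ⟨h.1.isParacompactHausdorff, h.2⟩
  tfae_have 1 → 3 := by
    rintro ⟨⟨_, _⟩, hK⟩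
    exact CozeroKernel.hasKernelSelections_of_isCompact hK
  tfae_have 3 → 4 := fun h => h.hasCompactLargestImageSelections
  tfae_have 4 → 5 := fun h => h.hasFiniteLargestImageSelections
  tfae_have 5 → 6 := fun h => ⟨h.t2Space, h.hasStarFiniteShrinkings⟩
  tfae_have 6 → 2 := by
    rintro ⟨_, h⟩
    have hs := h.isStronglyParacompact
    obtain ⟨-, _⟩ := hs.isParacompactHausdorff
    exact ⟨hs, h.isCompact_cozeroKernel⟩
  tfae_finish
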